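/- Let $(\mathcal C,\mathbb E,\mathfrak s)$ be an extriangulated category (in the sense of Nakaoka and Palu) satisfying the condition (WIC): if $gf$ is an inflation then $f$ is an inflation, and if $gf$ is a deflation then $g$ is a deflation. Let $\xi$ be a proper class of $\mathbb E$-triangles, i.e. a class of $\mathbb E$-triangles, closed under isomorphisms, that contains the split ones, is closed under finite coproducts, base change and cobase change (i.e. under passing from $\delta$ to $c^*\delta$ and $a_*\delta$), and is saturated: for $\mathbb E$-triangles $A_i\to B_i\xrightarrow{y_i}C\overset{\delta_i}{\dashrightarrow}$ $(i=1,2)$ and a commutative diagram consisting of them and $\mathbb E$-triangles $A_1\to N\to B_2\overset{y_2^*\delta_1}{\dashrightarrow}$ and $A_2\to N\to B_1\overset{y_1^*\delta_2}{\dashrightarrow}$ (the compositions $A_1\to N\to B_1$ and $A_2\to N\to B_2$ being the given morphisms and the square on $N,B_1,B_2,C$ commuting), if the $\mathbb E$-triangles of $\delta_2$ and $y_2^*\delta_1$ belong to $\xi$, then so does that of $\delta_1$. An object $P$ is $\xi$-projective, $P\in\mathcal P(\xi)$, if for every $\mathbb E$-triangle $A\to B\to C\dashrightarrow$ in $\xi$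 the sequence $0\to\mathcal C(P,A)\to\mathcal C(P,B)\to\mathcal C(P,C)\to 0$ is exact; $\xi$-injective objects are defined dually. Assume that $\mathcal C$ has enough $\xi$-projectives and enough $\xi$-injectives, i.e. for every object $A$ there are $\mathbb E$-triangles $K\to P\to A\dashrightarrow$ and $A\to I\to L\dashrightarrow$ in $\xi$ with $P$ $\xi$-projective and $I$ $\xi$-injective. An object $G$ is $\xi$-$\mathcal G$projective if $G\cong K_n$ for some $n$, where $(K_{n+1}\to P_n\to K_n\dashrightarrow)_{n\in\mathbb Z}$ is a family of $\mathbb E$-triangles in $\xi$ with all $P_n\in\mathcal P(\xi)$ such that $0\to\mathcal C(K_n,Q)\to\mathcal C(P_n,Q)\to\mathcal C(K_{n+1},Q)\to 0$ is exact for all $n\in\mathbb Z$ and all $Q\in\mathcal P(\xi)$. The $\xi$-projective dimension $\xi\text{-}\mathrm{pd}\,A\in\mathbb N_0\cup\{\infty\}$ is defined inductively: $\xi\text{-}\mathrm{pd}\,A\le 0$ if $A\in\mathcal P(\xi)$, and $\xi\text{-}\mathrm{pd}\,A\le n$ with $n\ge 1$ if $A\in\mathcal P(\xi)$ or there is an $\mathbb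 E$-triangle $K\to P\to A\dashrightarrow$ in $\xi$ with $P\in\mathcal P(\xi)$ and $\xi\text{-}\mathrm{pd}\,K\le n-1$. The $\xi$-$\mathcal G$projective dimension $\xi\text{-}\mathcal G\mathrm{pd}\,A$ is defined in the same way with $\xi$-$\mathcal G$projective objects instead of $\xi$-projective ones. Let $\widetilde{\mathcal P}(\xi)$ be the class of objects of finite $\xi$-projective dimension. A $\xi$-projective resolution of $A$ is a complex $\cdots\to P_1\to P_0$ of $\xi$-projective objects, with an augmentation $P_0\to A$, obtained by splicing $\mathbb E$-triangles $K_{n+1}\to P_n\to K_n\dashrightarrow$ $(n\ge 0)$ in $\xi$ with $K_0=A$; put $\xi\mathrm{xt}^i_\xi(A,B)=H^i(\mathcal C(\mathbf P,B))$ for such a resolution $\mathbf P$ of $A$ (up to isomorphism this does not depend on the resolution). Theorem. Let $M$ be an object of $\mathcal C$ of finite $\xi$-$\mathcal G$projective dimension. Then for every integer $n\ge 0$ the following are equivalent: (1) $\xi\text{-}\mathcal G\mathrm{pd}\,M\le n$; (2) $\xi\mathrm{xt}^i_\xi(M,Q)=0$ for all $Q\in\widetilde{\mathcal P}(\xi)$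 and all $i\ge n+1$; (3) $\xi\mathrm{xt}^i_\xi(M,Q)=0$ for all $Q\in\mathcal P(\xi)$ and all $i\ge n+1$. Furthermore, $$\xi\text{-}\mathcal G\mathrm{pd}\,M=\sup\{i\in\mathbb N_0 : \xi\mathrm{xt}^i_\xi(M,Q)\ne 0\text{ for some }Q\in\mathcal P(\xi)\}=\sup\{i\in\mathbb N_0 : \xi\mathrm{xt}^i_\xi(M,Q)\ne 0\text{ for some }Q\in\widetilde{\mathcal P}(\xi)\},$$ where the supremum of the empty set is $0$. -/

import Mathlib

open CategoryTheory CategoryTheory.Limits Opposite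

universe w v u

namespace Extri

section Extriangulated

variable (C : Type u) [Category.{v} C] [Preadditive C]

/-- A biadditive functor `E : Cᵒᵖ × C → Ab`, in curried form. -/
structure ExtBifunctor where
  E : Cᵒᵖ ⥤ C ⥤ AddCommGrpCat.{w}
  additive_right : ∀ X : Cᵒᵖ, (E.obj X).Additive
  additive_left : ∀ A : C, (E.flip.obj A).Additive

variable {C}

/-- `E(D, A)`, the abelian group of `E`-extensions of `D` by `A`. -/
abbrev ExtBifunctor.Ext (F : ExtBifunctor.{w} C) (D A : C) : Type w :=
  (F.E.obj (op D)).obj A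

/-- The pushforward `a_* δ`. -/
def ExtBifunctor.push (F : ExtBifunctor.{w} C) {D A A' : C} (a : A ⟶ A') (δ : F.Ext D A) :
    F.Ext D A' :=
  ((F.E.obj (op D)).map a).hom δ

/-- The pullback `c^* δ`. -/
def ExtBifunctor.pull (F : ExtBifunctor.{w} C) {D D' A : C} (c : D' ⟶ D) (δ : F.Ext D A) :
    F.Ext D' A :=
  ((F.E.map c.op).app A).hom δ

/-- The direct sum `δ ⊕ δ' ∈ E(D ⊕ D', A ⊕ A')` of two extensions: the element with components
`(δ, 0, 0, δ')`. -/
noncomputable def ExtBifunctor.sum [HasBinaryBiproducts C] (F : ExtBifunctor.{w} C)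
    {D A D' A' : C} (δ : F.Ext D A) (δ' : F.Ext D' A') : F.Ext (D ⊞ D') (A ⊞ A') :=
  F.push biprod.inl (F.pull biprod.fst δ) + F.push biprod.inr (F.pull biprod.snd δ')

/-- Sequences `A ⟶ B ⟶ D` with fixed ends `A` and `D`. -/
structure Seq (A D : C) where
  mid : C
  x : A ⟶ mid
  y : mid ⟶ D

/-- Two sequences with the same ends are equivalent if there is an isomorphism of the middle terms
compatible with the identities of the ends. -/
def Seq.Equiv {A D : C} (p q : Seq A D) : Prop :=
  ∃ b : p.mid ≅ q.mid, p.x ≫ b.hom = q.x ∧ b.hom ≫ q.y = p.y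

instance Seq.setoid (A D : C) : Setoid (Seq A D) where
  r := Seq.Equiv
  iseqv :=
    { refl := fun p => ⟨Iso.refl _, by simp, by simp⟩
      symm := by
        rintro p q ⟨b, h₁, h₂⟩
        exact ⟨b.symm, by simp [← h₁], by simp [← h₂]⟩
      trans := by
        rintro p q r ⟨b, h₁, h₂⟩ ⟨b', h₃, h₄⟩
        exact ⟨b ≪≫ b', by simp [reassoc_of% h₁, h₃], by simp [h₄, h₂]⟩ }

/-- Equivalence classes of sequences `A ⟶ B ⟶ D`. -/
abbrev SeqClass (A D : C) : Type (max u v) := Quotient (Seq.setoid A D)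

/-- The class `[A ⟶ B ⟶ D]`. -/
def cls {A B D : C} (x : A ⟶ B) (y : B ⟶ D) : SeqClass A D :=
  Quotient.mk _ ⟨B, x, y⟩

variable (C)

/-- An extriangulated structure `(E, s)` on an additive category, in the sense of
Nakaoka and Palu. -/
structure Extriangulated [HasZeroObject C] [HasBinaryBiproducts C] extends ExtBifunctor.{w} C where
  /-- the correspondence `δ ↦ s(δ) = [A ⟶ B ⟶ D]` -/
  s : ∀ {D A : C}, toExtBifunctor.Ext D A → SeqClass A D
  /-- `s` is a realization. -/
  realize : ∀ {A B D A' B' D' : C} (x : A ⟶ B) (y : B ⟶ D) (δ : toExtBifunctor.Ext D A)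
    (x' : A' ⟶ B') (y' : B' ⟶ D') (δ' : toExtBifunctor.Ext D' A'),
    s δ = cls x y → s δ' = cls x' y' → ∀ (a : A ⟶ A') (c : D ⟶ D'),
    toExtBifunctor.push a δ = toExtBifunctor.pull c δ' →
    ∃ b : B ⟶ B', x ≫ b = a ≫ x' ∧ b ≫ y' = y ≫ c
  /-- The realization is additive: zero extensions. -/
  s_zero : ∀ A D : C, s (0 : toExtBifunctor.Ext D A) =
    cls (biprod.inl : A ⟶ A ⊞ D) (biprod.snd : A ⊞ D ⟶ D)
  /-- The realization is additive: direct sums. -/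
  s_sum : ∀ {A B D A' B' D' : C} (x : A ⟶ B) (y : B ⟶ D) (δ : toExtBifunctor.Ext D A)
    (x' : A' ⟶ B') (y' : B' ⟶ D') (δ' : toExtBifunctor.Ext D' A'),
    s δ = cls x y → s δ' = cls x' y' →
    s (toExtBifunctor.sum δ δ') = cls (biprod.map x x') (biprod.map y y')
  /-- (ET3) -/
  et3 : ∀ {A B D A' B' D' : C} (x : A ⟶ B) (y : B ⟶ D) (δ : toExtBifunctor.Ext D A)
    (x' : A' ⟶ B') (y' : B' ⟶ D') (δ' : toExtBifunctor.Ext D' A'),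
    s δ = cls x y → s δ' = cls x' y' → ∀ (a : A ⟶ A') (b : B ⟶ B'), x ≫ b = a ≫ x' →
    ∃ c : D ⟶ D', y ≫ c = b ≫ y' ∧ toExtBifunctor.push a δ = toExtBifunctor.pull c δ'
  /-- (ET3)ᵒᵖ -/
  et3_op : ∀ {A B D A' B' D' : C} (x : A ⟶ B) (y : B ⟶ D) (δ : toExtBifunctor.Ext D A)
    (x' : A' ⟶ B') (y' : B' ⟶ D') (δ' : toExtBifunctor.Ext D' A'),
    s δ = cls x y → s δ' = cls x' y' → ∀ (b : B ⟶ B') (c : D ⟶ D'), y ≫ c = b ≫ y' →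
    ∃ a : A ⟶ A', x ≫ b = a ≫ x' ∧ toExtBifunctor.push a δ = toExtBifunctor.pull c δ'
  /-- (ET4) -/
  et4 : ∀ {A B D X F : C} (f : A ⟶ B) (f' : B ⟶ D) (δ : toExtBifunctor.Ext D A)
    (g : B ⟶ X) (g' : X ⟶ F) (δ' : toExtBifunctor.Ext F B),
    s δ = cls f f' → s δ' = cls g g' →
    ∃ (Y : C) (h : A ⟶ X) (h' : X ⟶ Y) (d : D ⟶ Y) (e : Y ⟶ F)
      (δ'' : toExtBifunctor.Ext Y A),
      h = f ≫ g ∧ f' ≫ d = g ≫ h' ∧ h' ≫ e = g' ∧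
      s δ'' = cls h h' ∧
      s (toExtBifunctor.push f' δ') = cls d e ∧
      toExtBifunctor.pull d δ'' = δ ∧
      toExtBifunctor.push f δ'' = toExtBifunctor.pull e δ'
  /-- (ET4)ᵒᵖ -/
  et4_op : ∀ {D A B F X : C} (f' : D ⟶ A) (f : A ⟶ B) (δ : toExtBifunctor.Ext B D)
    (g' : F ⟶ B) (g : B ⟶ X) (δ' : toExtBifunctor.Ext X F),
    s δ = cls f' f → s δ' = cls g' g →
    ∃ (Y : C) (d : D ⟶ Y) (e : Y ⟶ F) (h' : Y ⟶ A) (h : A ⟶ X)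
      (δ'' : toExtBifunctor.Ext X Y),
      h = f ≫ g ∧ d ≫ h' = f' ∧ e ≫ g' = h' ≫ f ∧
      s δ'' = cls h' h ∧
      s (toExtBifunctor.pull g' δ) = cls d e ∧
      toExtBifunctor.push e δ'' = δ' ∧
      toExtBifunctor.push d δ = toExtBifunctor.pull g δ''

variable {C} [HasZeroObject C] [HasBinaryBiproducts C]

namespace Extriangulated

variable (S : Extriangulated.{w} C)

/-- `A ⟶ B ⟶ D ⇢` with extension `δ` is an `E`-triangle. -/
def IsTriangle {A B D : C} (x : A ⟶ B) (y : B ⟶ D) (δ : S.Ext D A) : Prop :=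
  S.s δ = cls x y

def IsInflation {A B : C} (x : A ⟶ B) : Prop :=
  ∃ (D : C) (y : B ⟶ D) (δ : S.Ext D A), S.IsTriangle x y δ

def IsDeflation {B D : C} (y : B ⟶ D) : Prop :=
  ∃ (A : C) (x : A ⟶ B) (δ : S.Ext D A), S.IsTriangle x y δ

/-- Weak idempotent completeness (Condition (WIC) of Nakaoka and Palu). -/
def WeaklyIdempotentComplete : Prop :=
  (∀ {A B D : C} (f : A ⟶ B) (g : B ⟶ D), S.IsInflation (f ≫ g) → S.IsInflation f) ∧
  (∀ {A B D : C} (f : A ⟶ B) (g : B ⟶ D), S.IsDeflation (f ≫ g) → S.IsDeflation g)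

variable {S} in
lemma IsTriangle.comp_eq_zero {A B D : C} {x : A ⟶ B} {y : B ⟶ D} {δ : S.Ext D A}
    (h : S.IsTriangle x y δ) : x ≫ y = 0 := by
  obtain ⟨c, hc, -⟩ := S.et3 (biprod.inl : A ⟶ A ⊞ A) biprod.snd 0 x y δ
    (S.s_zero A A) h (𝟙 A) (biprod.desc x 0) (by simp)
  have h1 := congrArg (fun t => biprod.inl ≫ t) hc
  simpa using h1.symm

end Extriangulated

/-- A proper class `ξ` of `E`-triangles. -/
structure ProperClass (S : Extriangulated.{w} C) where
  /-- membership of `A ⟶ B ⟶ D ⇢` in `ξ` -/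
  mem : ∀ {A B D : C}, (A ⟶ B) → (B ⟶ D) → S.Ext D A → Prop
  isTriangle : ∀ {A B D : C} {x : A ⟶ B} {y : B ⟶ D} {δ : S.Ext D A},
    mem x y δ → S.IsTriangle x y δ
  /-- closed under isomorphisms of `E`-triangles -/
  closed_iso : ∀ {A B D A' B' D' : C} (x : A ⟶ B) (y : B ⟶ D) (δ : S.Ext D A)
    (x' : A' ⟶ B') (y' : B' ⟶ D') (δ' : S.Ext D' A') (a : A ≅ A') (b : B ≅ B') (c : D ≅ D'),
    mem x y δ → S.IsTriangle x' y' δ' → x ≫ b.hom = a.hom ≫ x' → y ≫ c.hom = b.hom ≫ y' →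
    S.push a.hom δ = S.pull c.hom δ' → mem x' y' δ'
  /-- closed under finite coproducts (the empty one is a split `E`-triangle) -/
  closed_sum : ∀ {A B D A' B' D' : C} (x : A ⟶ B) (y : B ⟶ D) (δ : S.Ext D A)
    (x' : A' ⟶ B') (y' : B' ⟶ D') (δ' : S.Ext D' A'), mem x y δ → mem x' y' δ' →
    mem (biprod.map x x') (biprod.map y y') (S.sum δ δ')
  /-- contains the split `E`-triangles -/
  split_mem : ∀ {A B D : C} (x : A ⟶ B) (y : B ⟶ D), S.IsTriangle x y 0 → mem x y 0
  /-- closed under base change -/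
  base_change : ∀ {A B D B' D' : C} (x : A ⟶ B) (y : B ⟶ D) (δ : S.Ext D A) (c : D' ⟶ D)
    (x' : A ⟶ B') (y' : B' ⟶ D'), mem x y δ → S.IsTriangle x' y' (S.pull c δ) →
    mem x' y' (S.pull c δ)
  /-- closed under cobase change -/
  cobase_change : ∀ {A B D A' B' : C} (x : A ⟶ B) (y : B ⟶ D) (δ : S.Ext D A) (a : A ⟶ A')
    (x' : A' ⟶ B') (y' : B' ⟶ D), mem x y δ → S.IsTriangle x' y' (S.push a δ) →
    mem x' y' (S.push a δ)
  /-- saturated -/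
  saturated : ∀ {A₁ B₁ A₂ B₂ D M : C} (x₁ : A₁ ⟶ B₁) (y₁ : B₁ ⟶ D) (δ₁ : S.Ext D A₁)
    (x₂ : A₂ ⟶ B₂) (y₂ : B₂ ⟶ D) (δ₂ : S.Ext D A₂)
    (m₁ : A₁ ⟶ M) (e₁ : M ⟶ B₂) (m₂ : A₂ ⟶ M) (e₂ : M ⟶ B₁),
    S.IsTriangle x₁ y₁ δ₁ → S.IsTriangle x₂ y₂ δ₂ →
    m₂ ≫ e₁ = x₂ → m₁ ≫ e₂ = x₁ → e₁ ≫ y₂ = e₂ ≫ y₁ →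
    S.IsTriangle m₁ e₁ (S.pull y₂ δ₁) → S.IsTriangle m₂ e₂ (S.pull y₁ δ₂) →
    mem x₂ y₂ δ₂ → mem m₁ e₁ (S.pull y₂ δ₁) → mem x₁ y₁ δ₁

/-- `0 ⟶ C(W, A) ⟶ C(W, B) ⟶ C(W, D) ⟶ 0` is exact. -/
def HomExactFrom (W : C) {A B D : C} (x : A ⟶ B) (y : B ⟶ D) : Prop :=
  Function.Injective (fun h : W ⟶ A => h ≫ x) ∧
  Function.Exact (fun h : W ⟶ A => h ≫ x) (fun h : W ⟶ B => h ≫ y) ∧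
  Function.Surjective (fun h : W ⟶ B => h ≫ y)

/-- `0 ⟶ C(D, W) ⟶ C(B, W) ⟶ C(A, W) ⟶ 0` is exact. -/
def HomExactTo (W : C) {A B D : C} (x : A ⟶ B) (y : B ⟶ D) : Prop :=
  Function.Injective (fun h : D ⟶ W => y ≫ h) ∧
  Function.Exact (fun h : D ⟶ W => y ≫ h) (fun h : B ⟶ W => x ≫ h) ∧
  Function.Surjective (fun h : B ⟶ W => x ≫ h)

namespace ProperClass

variable {S : Extriangulated.{w} C} (ξ : ProperClass S)

/-- `P` is `ξ`-projective. -/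
def IsProjective (P : C) : Prop :=
  ∀ {A B D : C} (x : A ⟶ B) (y : B ⟶ D) (δ : S.Ext D A), ξ.mem x y δ → HomExactFrom P x y

/-- `I` is `ξ`-injective. -/
def IsInjective (I : C) : Prop :=
  ∀ {A B D : C} (x : A ⟶ B) (y : B ⟶ D) (δ : S.Ext D A), ξ.mem x y δ → HomExactTo I x y

class EnoughProjectives : Prop where
  exists_cover : ∀ A : C, ∃ (K P : C) (g : K ⟶ P) (f : P ⟶ A) (δ : S.Ext A K),
    ξ.mem g f δ ∧ ξ.IsProjective P

class EnoughInjectives : Prop where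
  exists_hull : ∀ A : C, ∃ (I K : C) (g : A ⟶ I) (f : I ⟶ K) (δ : S.Ext K A),
    ξ.mem g f δ ∧ ξ.IsInjective I

/-- For a class `𝒲` of objects, `DimLE 𝒲 n A` says that the dimension of `A` relative to `𝒲`,
defined inductively by `E`-triangles `K ⟶ W ⟶ A ⇢` in `ξ` with `W ∈ 𝒲`, is at most `n`. -/
def DimLE (𝒲 : C → Prop) : ℕ → C → Prop
  | 0, A => 𝒲 A
  | n + 1, A => 𝒲 A ∨ ∃ (K W : C) (g : K ⟶ W) (f : W ⟶ A) (δ : S.Ext A K),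
      ξ.mem g f δ ∧ 𝒲 W ∧ DimLE 𝒲 n K

/-- The dimension of `A` relative to `𝒲`; it is `⊤` if no `n` satisfies `DimLE 𝒲 n A`. -/
noncomputable def dim (𝒲 : C → Prop) (A : C) : ℕ∞ :=
  ⨅ (n : ℕ) (_ : ξ.DimLE 𝒲 n A), (n : ℕ∞)

/-- The `ξ`-projective dimension. -/
noncomputable def pd (A : C) : ℕ∞ := ξ.dim ξ.IsProjective A

/-- Data exhibiting a complex `X` as `ξ`-exact: `E`-triangles
`K (n+1) ⟶ X n ⟶ K n ⇢` in `ξ` through which the differentials factor. -/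
structure ExactData (X : ChainComplex C ℤ) where
  K : ℤ → C
  g : ∀ n, K (n + 1) ⟶ X.X n
  f : ∀ n, X.X n ⟶ K n
  δ : ∀ n, S.Ext (K n) (K (n + 1))
  mem : ∀ n, ξ.mem (g n) (f n) (δ n)
  d_eq : ∀ n, X.d (n + 1) n = f (n + 1) ≫ g n

/-- `X`, with the chosen `E`-triangles, is a complete `ξ`-projective resolution: its terms are
`ξ`-projective and the chosen `E`-triangles are `C(-, P(ξ))`-exact. -/
structure IsCompleteResolution {X : ChainComplex C ℤ} (e : ξ.ExactData X) : Prop where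
  projective : ∀ n, ξ.IsProjective (X.X n)
  exact : ∀ (n : ℤ) (Q : C), ξ.IsProjective Q → HomExactTo Q (e.g n) (e.f n)

/-- `G` is `ξ`-Gorenstein projective: it is one of the objects `K n` attached to a complete
`ξ`-projective resolution. -/
def IsGProjective (G : C) : Prop :=
  ∃ (X : ChainComplex C ℤ) (e : ξ.ExactData X), ξ.IsCompleteResolution e ∧
    ∃ n : ℤ, Nonempty (G ≅ e.K n)

/-- The `ξ`-Gorenstein projective dimension. -/
noncomputable def Gpd (A : C) : ℕ∞ := ξ.dim ξ.IsGProjective A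

/-- A `ξ`-projective resolution `⋯ ⟶ P 1 ⟶ P 0 ⟶ A`: there are `E`-triangles
`K (n+1) ⟶ P n ⟶ K n ⇢` in `ξ` with `K 0 = A` through which the differentials factor (the
augmentation being `f 0` followed by the identification `K 0 ≅ A`). -/
structure ProjectiveResolution (A : C) where
  P : ChainComplex C ℕ
  projective : ∀ n, ξ.IsProjective (P.X n)
  K : ℕ → C
  iso : K 0 ≅ A
  g : ∀ n, K (n + 1) ⟶ P.X n
  f : ∀ n, P.X n ⟶ K n
  δ : ∀ n, S.Ext (K n) (K (n + 1))
  mem : ∀ n, ξ.mem (g n) (f n) (δ n)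
  d_eq : ∀ n, P.d (n + 1) n = f (n + 1) ≫ g n

lemma nonempty_projectiveResolution [h : ξ.EnoughProjectives] (A : C) :
    Nonempty (ξ.ProjectiveResolution A) := by
  choose k p g f δ hm hp using h.exists_cover
  let K : ℕ → C := fun n => Nat.rec A (fun _ X => k X) n
  refine ⟨{
    P := ChainComplex.of (fun n => p (K n)) (fun n => f (K (n + 1)) ≫ g (K n)) ?_
    projective := fun n => hp _
    K := K
    iso := Iso.refl _
    g := fun n => g (K n)
    f := fun n => f (K n)
    δ := fun n => δ (K n)
    mem := fun n => hm _
    d_eq := fun n => ?_ }⟩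
  · intro n
    have h0 : g (K (n + 1)) ≫ f (K (n + 1)) = 0 := (ξ.isTriangle (hm (K (n + 1)))).comp_eq_zero
    calc (f (K (n + 1 + 1)) ≫ g (K (n + 1))) ≫ f (K (n + 1)) ≫ g (K n)
        = f (K (n + 1 + 1)) ≫ (g (K (n + 1)) ≫ f (K (n + 1))) ≫ g (K n) := by
          simp only [Category.assoc]
      _ = 0 := by rw [h0]; simp
  · simp only [ChainComplex.of_d]

/-- A chosen `ξ`-projective resolution. -/
noncomputable def projectiveResolution [ξ.EnoughProjectives] (A : C) : ξ.ProjectiveResolution A :=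
  (ξ.nonempty_projectiveResolution A).some

/-- The `ξ`-cohomology group: the `n`-th cohomology of the complex of abelian groups
`C(P, B)`, where `P` is a `ξ`-projective resolution of `A`. -/
noncomputable def xt [ξ.EnoughProjectives] (n : ℕ) (A B : C) : AddCommGrpCat.{v} :=
  (((preadditiveYoneda.obj B).mapHomologicalComplex _).obj
    (ξ.projectiveResolution A).P.op).homology n

end ProperClass

end Extriangulated

end Extri

/-!
The argument is relative homological algebra for `ξ`, made possible by one observation: with enough
projectives, an `E`-triangle belongs to `ξ` if and only if its deflation has the lifting property
for maps from `ξ`-projective objects (`mem_iff`). Indeed, such a triangle splits when pulled back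
along a projective cover, and saturation applies to the resulting pullback square
(`exists_pullback`). Membership in `ξ` thus becomes a property `IsProper` of the extension that is
stable under pullback and pushout, and composites of `ξ`-inflations and of `ξ`-deflations are
obtained from (ET4) and its dual.

Gorenstein projective objects are handled by coinduction: they form the largest class of objects
orthogonal to the projectives (`IsOrthogonal`) each of which has a projective cover and a
projective hull whose third terms are again in the class (`IsTotallyAcyclic`). This gives closure
under extensions, removal of projective summands, kernels of `ξ`-deflations, and those cokernels
for which maps to projectives extend (`IsGProjective.of_ext`, `of_biprod`, `of_kernel`,
`of_cokernel`).

If the Gorenstein projective dimension of `M` is at most `n`, comparing covers shows that all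
syzygies `K j` with `n ≤ j` of any projective resolution are Gorenstein projective, so
`C(P, Q)` is exact in degrees above `n` for `Q` projective; dimension shifting in `Q` extends this
to `Q` of finite projective dimension. Conversely, finiteness of the dimension makes a high syzygy
Gorenstein projective, and exactness of `C(P, Q)` in degrees above `n` carries this down to `K n`
with `IsGProjective.of_cokernel`. The formulas for the dimension as a supremum are formal
consequences.
-/

open scoped ZeroObject

namespace Extri

/-! ### Functoriality of extensions -/

section Bifunctor

variable {C : Type u} [Category.{v} C] [Preadditive C] (F : ExtBifunctor.{w} C)

namespace ExtBifunctor

variable {D D' D'' A A' A'' : C}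

@[simp] lemma push_id (δ : F.Ext D A) : F.push (𝟙 A) δ = δ := by simp [push]

@[simp] lemma pull_id (δ : F.Ext D A) : F.pull (𝟙 D) δ = δ := by simp [pull]

lemma push_comp (a : A ⟶ A') (a' : A' ⟶ A'') (δ : F.Ext D A) :
    F.push (a ≫ a') δ = F.push a' (F.push a δ) := by simp [push]

lemma pull_comp (c : D'' ⟶ D') (c' : D' ⟶ D) (δ : F.Ext D A) :
    F.pull (c ≫ c') δ = F.pull c (F.pull c' δ) := by simp [pull]

lemma push_pull (a : A ⟶ A') (c : D' ⟶ D) (δ : F.Ext D A) :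
    F.push a (F.pull c δ) = F.pull c (F.push a δ) :=
  (ConcreteCategory.congr_hom ((F.E.map c.op).naturality a) δ).symm

@[simp] lemma push_add (a : A ⟶ A') (δ δ' : F.Ext D A) :
    F.push a (δ + δ') = F.push a δ + F.push a δ' := map_add _ _ _

@[simp] lemma pull_add (c : D' ⟶ D) (δ δ' : F.Ext D A) :
    F.pull c (δ + δ') = F.pull c δ + F.pull c δ' := map_add _ _ _

@[simp] lemma push_zero (a : A ⟶ A') : F.push a (0 : F.Ext D A) = 0 := map_zero _

@[simp] lemma pull_zero (c : D' ⟶ D) : F.pull c (0 : F.Ext D A) = 0 := map_zero _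

@[simp] lemma zero_push (δ : F.Ext D A) : F.push (0 : A ⟶ A') δ = 0 := by
  have := F.additive_right (op D)
  simp [push]

@[simp] lemma zero_pull (δ : F.Ext D A) : F.pull (0 : D' ⟶ D) δ = 0 := by
  have := F.additive_left A
  have h : (F.E.flip.obj A).map (0 : D' ⟶ D).op = 0 := by
    rw [op_zero]; exact Functor.map_zero _ _ _
  exact ConcreteCategory.congr_hom h δ

end ExtBifunctor

end Bifunctor

/-! ### Basic properties of `E`-triangles -/

variable {C : Type u} [Category.{v} C] [Preadditive C] [HasZeroObject C] [HasBinaryBiproducts C]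

namespace Extriangulated

variable {S : Extriangulated.{w} C}

lemma exists_isTriangle {D A : C} (δ : S.Ext D A) :
    ∃ (B : C) (x : A ⟶ B) (y : B ⟶ D), S.IsTriangle x y δ := by
  obtain ⟨⟨B, x, y⟩, h⟩ := Quotient.exists_rep (S.s δ)
  exact ⟨B, x, y, h.symm⟩

lemma isTriangle_biprod (A D : C) :
    S.IsTriangle (biprod.inl : A ⟶ A ⊞ D) biprod.snd 0 := S.s_zero A D

namespace IsTriangle

variable {A B D : C} {x : A ⟶ B} {y : B ⟶ D} {δ : S.Ext D A}

lemma exists_iso (h : S.IsTriangle x y δ) {B' : C} {x' : A ⟶ B'} {y' : B' ⟶ D}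
    (h' : S.IsTriangle x' y' δ) : ∃ b : B ≅ B', x ≫ b.hom = x' ∧ b.hom ≫ y' = y :=
  Quotient.exact (h.symm.trans h')

lemma of_iso_mid (h : S.IsTriangle x y δ) {B' : C} (b : B ≅ B') :
    S.IsTriangle (x ≫ b.hom) (b.inv ≫ y) δ :=
  h.trans (Quotient.sound ⟨b, rfl, by simp⟩)

lemma exists_desc (h : S.IsTriangle x y δ) {W : C} (b : B ⟶ W) (hb : x ≫ b = 0) :
    ∃ c : D ⟶ W, y ≫ c = b := by
  obtain ⟨c, hc, -⟩ := S.et3 x y δ (biprod.inl : (0 : C) ⟶ 0 ⊞ W) biprod.snd 0 h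
    (S.s_zero _ _) 0 (biprod.lift 0 b) (by ext; simp [hb])
  exact ⟨c, by simpa using hc⟩

lemma exists_lift (h : S.IsTriangle x y δ) {W : C} (b : W ⟶ B) (hb : b ≫ y = 0) :
    ∃ a : W ⟶ A, a ≫ x = b := by
  obtain ⟨a, ha, -⟩ := S.et3_op (biprod.inl : W ⟶ W ⊞ 0) biprod.snd 0 x y δ
    (S.s_zero _ _) h (biprod.desc b 0) 0 (by ext; simp [hb])
  exact ⟨a, by simpa using ha.symm⟩

lemma push_left_eq_zero (h : S.IsTriangle x y δ) : S.push x δ = 0 := by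
  obtain ⟨c, -, hc⟩ := S.et3 x y δ (biprod.inl : B ⟶ B ⊞ (0 : C)) biprod.snd 0 h
    (S.s_zero _ _) x biprod.inl rfl
  simpa using hc

lemma pull_right_eq_zero (h : S.IsTriangle x y δ) : S.pull y δ = 0 := by
  obtain ⟨a, -, ha⟩ := S.et3_op (biprod.inl : (0 : C) ⟶ 0 ⊞ B) biprod.snd 0 x y δ
    (S.s_zero _ _) h biprod.snd y rfl
  simpa using ha.symm

lemma pull_eq_zero_iff (h : S.IsTriangle x y δ) {W : C} (c : W ⟶ D) :
    S.pull c δ = 0 ↔ ∃ b : W ⟶ B, b ≫ y = c := by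
  constructor
  · intro hc
    obtain ⟨b, -, hb⟩ := S.realize _ _ 0 x y δ (S.s_zero A W) h (𝟙 A) c (by simp [hc])
    exact ⟨biprod.inr ≫ b, by simp [hb]⟩
  · rintro ⟨b, rfl⟩
    rw [S.pull_comp, h.pull_right_eq_zero, S.pull_zero]

lemma push_eq_zero_iff (h : S.IsTriangle x y δ) {W : C} (a : A ⟶ W) :
    S.push a δ = 0 ↔ ∃ b : B ⟶ W, x ≫ b = a := by
  constructor
  · intro ha
    obtain ⟨b, hb, -⟩ := S.realize x y δ _ _ 0 h (S.s_zero W D) a (𝟙 D) (by simp [ha])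
    exact ⟨b ≫ biprod.fst, by simp [reassoc_of% hb]⟩
  · rintro ⟨b, rfl⟩
    rw [S.push_comp, h.push_left_eq_zero, S.push_zero]

/-- An endomorphism of an `E`-triangle that is the identity at both ends is an isomorphism in
the middle: its difference from the identity has square zero. -/
lemma isIso_of_endo (h : S.IsTriangle x y δ) (b : B ⟶ B) (hx : x ≫ b = x) (hy : b ≫ y = y) :
    IsIso b := by
  obtain ⟨t, ht⟩ := h.exists_lift (b - 𝟙 B) (by simp [hy])
  have hsq : (b - 𝟙 B) ≫ (b - 𝟙 B) = 0 := by
    conv_lhs => enter [1]; rw [← ht]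
    simp [hx]
  have hb : b ≫ b = b + b - 𝟙 B := by
    simp only [Preadditive.sub_comp, Preadditive.comp_sub, Category.comp_id,
      Category.id_comp] at hsq
    rw [← sub_eq_zero, ← hsq]; abel
  refine ⟨𝟙 B + 𝟙 B - b, ?_, ?_⟩ <;> simp [hb]

/-- A morphism of `E`-triangles that is an isomorphism at both ends is an isomorphism in the
middle, for some choice of the middle morphism. -/
lemma exists_iso_of_ends (h : S.IsTriangle x y δ) {A' B' D' : C} {x' : A' ⟶ B'} {y' : B' ⟶ D'}
    {δ' : S.Ext D' A'} (h' : S.IsTriangle x' y' δ') (a : A ≅ A') (c : D ≅ D')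
    (e : S.push a.hom δ = S.pull c.hom δ') :
    ∃ b : B ≅ B', x ≫ b.hom = a.hom ≫ x' ∧ b.hom ≫ y' = y ≫ c.hom := by
  have e' : S.push a.inv δ' = S.pull c.inv δ := by
    have := congrArg (fun t => S.push a.inv (S.pull c.inv t)) e
    simp only [← S.push_pull, ← S.push_comp, ← S.pull_comp, Iso.hom_inv_id, Iso.inv_hom_id,
      S.push_id, S.pull_id] at this
    exact this.symm
  obtain ⟨b, hb₁, hb₂⟩ := S.realize x y δ x' y' δ' h h' a.hom c.hom e
  obtain ⟨b', hb₁', hb₂'⟩ := S.realize x' y' δ' x y δ h' h a.inv c.inv e'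
  have i₁ : IsIso (b ≫ b') := h.isIso_of_endo _ (by simp [reassoc_of% hb₁, hb₁'])
    (by simp [hb₂', reassoc_of% hb₂])
  have i₂ : IsIso (b' ≫ b) := h'.isIso_of_endo _ (by simp [reassoc_of% hb₁', hb₁])
    (by simp [hb₂, reassoc_of% hb₂'])
  have : IsSplitMono b := ⟨⟨b' ≫ inv (b ≫ b'), by rw [← Category.assoc, IsIso.hom_inv_id]⟩⟩
  have : IsSplitEpi b := ⟨⟨inv (b' ≫ b) ≫ b', by rw [Category.assoc, IsIso.inv_hom_id]⟩⟩
  have : IsIso b := isIso_of_mono_of_isSplitEpi b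
  exact ⟨asIso b, hb₁, hb₂⟩

lemma of_iso_ends (h : S.IsTriangle x y δ) {A' D' : C} (a : A ≅ A') (c : D ≅ D') :
    S.IsTriangle (a.inv ≫ x) (y ≫ c.hom) (S.push a.hom (S.pull c.inv δ)) := by
  obtain ⟨B', x', y', h'⟩ := exists_isTriangle (S.push a.hom (S.pull c.inv δ))
  obtain ⟨b, hb₁, hb₂⟩ := h.exists_iso_of_ends h' a c (by
    rw [← S.push_pull, ← S.pull_comp]; simp)
  refine h'.trans (Quotient.sound ⟨b.symm, ?_, ?_⟩)
  · simp [Iso.comp_inv_eq, hb₁]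
  · simp [Iso.inv_comp_eq, hb₂]

lemma of_iso_right (h : S.IsTriangle x y δ) {D' : C} (c : D ≅ D') :
    S.IsTriangle x (y ≫ c.hom) (S.pull c.inv δ) := by
  simpa using h.of_iso_ends (Iso.refl _) c

lemma of_iso_left (h : S.IsTriangle x y δ) {A' : C} (a : A ≅ A') :
    S.IsTriangle (a.inv ≫ x) y (S.push a.hom δ) := by
  simpa using h.of_iso_ends a (Iso.refl _)

end IsTriangle

lemma isTriangle_biprod' (A D : C) :
    S.IsTriangle (biprod.inr : A ⟶ D ⊞ A) biprod.fst 0 := by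
  have h : (biprod.inl : A ⟶ A ⊞ D) ≫ biprod.lift biprod.snd biprod.fst = biprod.inr := by
    ext <;> simp
  simpa [h] using (isTriangle_biprod (S := S) A D).of_iso_mid (biprod.braiding A D)

lemma isTriangle_id_left (A : C) : S.IsTriangle (𝟙 A) (0 : A ⟶ 0) 0 := by
  have := (isTriangle_biprod (S := S) A 0).of_iso_mid
    ⟨biprod.fst, biprod.inl, by ext; simp, by simp⟩
  simpa using this

lemma isTriangle_id_right (A : C) : S.IsTriangle (0 : 0 ⟶ A) (𝟙 A) 0 := by
  have := (isTriangle_biprod (S := S) 0 A).of_iso_mid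
    ⟨biprod.snd, biprod.inr, by ext; simp, by simp⟩
  simpa using this

/-- The direct sum of an `E`-triangle with `Q ⟶ Q ⟶ 0 ⇢`. -/
lemma IsTriangle.biprod_left {A B D : C} {x : A ⟶ B} {y : B ⟶ D} {δ : S.Ext D A}
    (h : S.IsTriangle x y δ) (Q : C) :
    S.IsTriangle (biprod.map (𝟙 Q) x) (biprod.snd ≫ y) (S.push biprod.inr δ) := by
  have h₁ := S.s_sum _ _ 0 _ _ _ (isTriangle_id_left (S := S) Q) h
  have h₂ := IsTriangle.of_iso_right h₁
    ⟨biprod.snd, biprod.inr, by ext; simp, by simp⟩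
  simpa [ExtBifunctor.sum, ← S.push_pull, ← S.pull_comp] using h₂

/-- The direct sum of an `E`-triangle with `0 ⟶ Q ⟶ Q ⇢`. -/
lemma IsTriangle.biprod_right {A B D : C} {x : A ⟶ B} {y : B ⟶ D} {δ : S.Ext D A}
    (h : S.IsTriangle x y δ) (Q : C) :
    S.IsTriangle (x ≫ biprod.inl) (biprod.map y (𝟙 Q)) (S.pull biprod.fst δ) := by
  have h₁ := S.s_sum _ _ _ _ _ 0 h (isTriangle_id_right (S := S) Q)
  have h₂ := IsTriangle.of_iso_left h₁
    ⟨biprod.fst, biprod.inl, by ext; simp, by simp⟩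
  simpa [ExtBifunctor.sum, ← S.push_comp] using h₂

/-! ### Pullback and pushout squares -/

/-- One half of the pullback square: if the extension `θ` by a biproduct `Z` of `A₁` and `A₂` has
components `δ₁` and `δ₂`, then its realization is an extension of the middle term of `δ₂`
by `A₁`. -/
lemma exists_pullback_half {A₁ A₂ Z D B₂ N : C} {i₁ : A₁ ⟶ Z} {p₁ : Z ⟶ A₁} {p₂ : Z ⟶ A₂}
    (hZ : S.IsTriangle i₁ p₂ 0) (hp : i₁ ≫ p₁ = 𝟙 A₁) {z : Z ⟶ N} {w : N ⟶ D} {θ : S.Ext D Z}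
    (hθ : S.IsTriangle z w θ) {x₂ : A₂ ⟶ B₂} {y₂ : B₂ ⟶ D} {δ₂ : S.Ext D A₂}
    (h₂ : S.IsTriangle x₂ y₂ δ₂) {δ₁ : S.Ext D A₁} (e₁ : S.push p₁ θ = δ₁)
    (e₂ : S.push p₂ θ = δ₂) :
    ∃ e : N ⟶ B₂, S.IsTriangle (i₁ ≫ z) e (S.pull y₂ δ₁) ∧ e ≫ y₂ = w ∧ z ≫ e = p₂ ≫ x₂ := by
  obtain ⟨Y, h, h', d, e, δ'', rfl, hd, he, ht, hY, -, hpush⟩ := S.et4 _ _ _ _ _ _ hZ hθ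
  rw [e₂] at hY
  obtain ⟨b, hb₁, hb₂⟩ := IsTriangle.exists_iso hY h₂
  have hδ : δ'' = S.pull e δ₁ := by
    rw [← e₁, ← S.push_pull, ← hpush, ← S.push_comp, hp, S.push_id]
  refine ⟨h' ≫ b.hom, ?_, by simp [hb₂, he], by simp [← reassoc_of% hd, hb₁]⟩
  have := IsTriangle.of_iso_right ht b
  rwa [hδ, ← hb₂, ← S.pull_comp, Iso.inv_hom_id_assoc] at this

/-- Two `E`-triangles ending in the same object fit into a square with `E`-triangles
as rows and columns. -/
lemma exists_pullback {A₁ A₂ B₁ B₂ D : C} {x₁ : A₁ ⟶ B₁} {y₁ : B₁ ⟶ D} {δ₁ : S.Ext D A₁}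
    {x₂ : A₂ ⟶ B₂} {y₂ : B₂ ⟶ D} {δ₂ : S.Ext D A₂} (h₁ : S.IsTriangle x₁ y₁ δ₁)
    (h₂ : S.IsTriangle x₂ y₂ δ₂) :
    ∃ (N : C) (m₁ : A₁ ⟶ N) (e₁ : N ⟶ B₂) (m₂ : A₂ ⟶ N) (e₂ : N ⟶ B₁),
      m₂ ≫ e₁ = x₂ ∧ m₁ ≫ e₂ = x₁ ∧ e₁ ≫ y₂ = e₂ ≫ y₁ ∧
      S.IsTriangle m₁ e₁ (S.pull y₂ δ₁) ∧ S.IsTriangle m₂ e₂ (S.pull y₁ δ₂) := by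
  obtain ⟨N, z, w, hθ⟩ := exists_isTriangle
    (S.push (biprod.inl : A₁ ⟶ A₁ ⊞ A₂) δ₁ + S.push biprod.inr δ₂)
  have q₁ : S.push biprod.fst
      (S.push (biprod.inl : A₁ ⟶ A₁ ⊞ A₂) δ₁ + S.push biprod.inr δ₂) = δ₁ := by
    simp [← S.push_comp]
  have q₂ : S.push biprod.snd
      (S.push (biprod.inl : A₁ ⟶ A₁ ⊞ A₂) δ₁ + S.push biprod.inr δ₂) = δ₂ := by
    simp [← S.push_comp]
  obtain ⟨e₁, t₁, u₁, v₁⟩ := exists_pullback_half (isTriangle_biprod A₁ A₂) (by simp) hθ h₂ q₁ q₂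
  obtain ⟨e₂, t₂, u₂, v₂⟩ := exists_pullback_half (isTriangle_biprod' A₂ A₁) (by simp) hθ h₁ q₂ q₁
  exact ⟨N, _, e₁, _, e₂, by simp [v₁], by simp [v₂], u₁.trans u₂.symm, t₁, t₂⟩

/-- The dual of `exists_pullback_half`, for an extension `θ` of a biproduct `Z` of `D₁`
and `D₂`. -/
lemma exists_pushout_half {D₁ D₂ Z A B₂ N : C} {p₁ : Z ⟶ D₁} {i₁ : D₁ ⟶ Z} {i₂ : D₂ ⟶ Z}
    (hZ : S.IsTriangle i₂ p₁ 0) (hp : i₁ ≫ p₁ = 𝟙 D₁) {z : A ⟶ N} {w : N ⟶ Z} {θ : S.Ext Z A}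
    (hθ : S.IsTriangle z w θ) {x₂ : A ⟶ B₂} {y₂ : B₂ ⟶ D₂} {δ₂ : S.Ext D₂ A}
    (h₂ : S.IsTriangle x₂ y₂ δ₂) {δ₁ : S.Ext D₁ A} (e₁ : S.pull i₁ θ = δ₁)
    (e₂ : S.pull i₂ θ = δ₂) :
    ∃ m : B₂ ⟶ N, S.IsTriangle m (w ≫ p₁) (S.push x₂ δ₁) := by
  obtain ⟨Y, d, e, h', h, δ'', rfl, hd, he, ht, hY, -, hpush⟩ := S.et4_op _ _ _ _ _ _ hθ hZ
  rw [e₂] at hY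
  obtain ⟨b, hb₁, hb₂⟩ := IsTriangle.exists_iso hY h₂
  have hδ : δ'' = S.push d δ₁ := by
    rw [← e₁, S.push_pull, hpush, ← S.pull_comp, hp, S.pull_id]
  have := IsTriangle.of_iso_left ht b
  rw [hδ, ← S.push_comp, hb₁] at this
  exact ⟨_, this⟩

/-- Two `E`-triangles starting at the same object fit into a square with `E`-triangles
`B₂ ⟶ N ⟶ D₁ ⇢` and `B₁ ⟶ N ⟶ D₂ ⇢` as columns and rows. -/
lemma exists_pushout {A B₁ B₂ D₁ D₂ : C} {x₁ : A ⟶ B₁} {y₁ : B₁ ⟶ D₁} {δ₁ : S.Ext D₁ A}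
    {x₂ : A ⟶ B₂} {y₂ : B₂ ⟶ D₂} {δ₂ : S.Ext D₂ A} (h₁ : S.IsTriangle x₁ y₁ δ₁)
    (h₂ : S.IsTriangle x₂ y₂ δ₂) :
    ∃ (N : C) (m₁ : B₂ ⟶ N) (e₁ : N ⟶ D₁) (m₂ : B₁ ⟶ N) (e₂ : N ⟶ D₂),
      S.IsTriangle m₁ e₁ (S.push x₂ δ₁) ∧ S.IsTriangle m₂ e₂ (S.push x₁ δ₂) := by
  obtain ⟨N, z, w, hθ⟩ := exists_isTriangle
    (S.pull (biprod.fst : D₁ ⊞ D₂ ⟶ D₁) δ₁ + S.pull biprod.snd δ₂)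
  have q₁ : S.pull biprod.inl
      (S.pull (biprod.fst : D₁ ⊞ D₂ ⟶ D₁) δ₁ + S.pull biprod.snd δ₂) = δ₁ := by
    simp [← S.pull_comp]
  have q₂ : S.pull biprod.inr
      (S.pull (biprod.fst : D₁ ⊞ D₂ ⟶ D₁) δ₁ + S.pull biprod.snd δ₂) = δ₂ := by
    simp [← S.pull_comp]
  obtain ⟨m₁, t₁⟩ := exists_pushout_half (isTriangle_biprod' D₂ D₁) (by simp) hθ h₂ q₁ q₂
  obtain ⟨m₂, t₂⟩ := exists_pushout_half (isTriangle_biprod D₁ D₂) (by simp) hθ h₁ q₂ q₁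
  exact ⟨N, m₁, _, m₂, _, t₁, t₂⟩

/-- Exactness of `E(D, Q) ⟶ E(B, Q) ⟶ E(A, Q)` for an `E`-triangle `A ⟶ B ⟶ D ⇢`. -/
lemma IsTriangle.exists_pull_eq {A B D : C} {x : A ⟶ B} {y : B ⟶ D} {δ : S.Ext D A}
    (h : S.IsTriangle x y δ) {Q : C} (η : S.Ext B Q) (hη : S.pull x η = 0) :
    ∃ θ : S.Ext D Q, S.pull y θ = η := by
  obtain ⟨E, u, v, hE⟩ := exists_isTriangle η
  obtain ⟨Y, d, e, h', h, δ'', -, -, -, -, hY, -, hpush⟩ := S.et4_op _ _ _ _ _ _ hE h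
  rw [hη] at hY
  obtain ⟨r, hr⟩ := (IsTriangle.push_eq_zero_iff hY (𝟙 Q)).1 (by simp)
  refine ⟨S.push r δ'', ?_⟩
  rw [← S.push_pull, ← hpush, ← S.push_comp, hr, S.push_id]

end Extriangulated

variable {S : Extriangulated.{w} C}

namespace ProperClass

open Extriangulated

/-! ### Detecting `ξ` by projectives -/

section Projective

variable (ξ : ProperClass S)

lemma isProjective_zero : ξ.IsProjective (0 : C) := by
  intro A B D x y δ _
  refine ⟨fun _ _ _ => (isZero_zero C).eq_of_src _ _, fun _ => ⟨fun _ => ⟨0, ?_⟩, fun _ => ?_⟩,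
    fun _ => ⟨0, ?_⟩⟩ <;> exact (isZero_zero C).eq_of_src _ _

variable {ξ}

lemma IsProjective.biprod {P Q : C} (hP : ξ.IsProjective P) (hQ : ξ.IsProjective Q) :
    ξ.IsProjective (P ⊞ Q) := by
  intro A B D x y δ h
  have ht := ξ.isTriangle h
  obtain ⟨p₁, -, p₃⟩ := hP x y δ h
  obtain ⟨q₁, -, q₃⟩ := hQ x y δ h
  refine ⟨fun a b hab => ?_, fun b => ⟨fun hb => ht.exists_lift b hb, ?_⟩, fun d => ?_⟩
  · dsimp only at hab
    ext
    · exact p₁ (by simp [hab])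
    · exact q₁ (by simp [hab])
  · rintro ⟨a, rfl⟩
    simp [ht.comp_eq_zero]
  · obtain ⟨b, hb⟩ := p₃ (biprod.inl ≫ d)
    obtain ⟨b', hb'⟩ := q₃ (biprod.inr ≫ d)
    refine ⟨biprod.desc b b', ?_⟩
    dsimp only at hb hb' ⊢
    ext <;> simp [hb, hb']

lemma IsProjective.exists_lift {P : C} (hP : ξ.IsProjective P) {A B D : C} {x : A ⟶ B}
    {y : B ⟶ D} {δ : S.Ext D A} (h : ξ.mem x y δ) (p : P ⟶ D) : ∃ q : P ⟶ B, q ≫ y = p :=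
  (hP x y δ h).2.2 p

variable (ξ)

/-- An extension is proper if its pullbacks to all `ξ`-projective objects vanish. -/
def IsProper {D A : C} (δ : S.Ext D A) : Prop :=
  ∀ ⦃P : C⦄ (p : P ⟶ D), ξ.IsProjective P → S.pull p δ = 0

variable {ξ}

lemma IsProper.push {D A A' : C} {δ : S.Ext D A} (h : ξ.IsProper δ) (a : A ⟶ A') :
    ξ.IsProper (S.push a δ) := fun P p hP => by
  rw [← S.push_pull, h p hP, S.push_zero]

lemma IsProper.pull {D D' A : C} {δ : S.Ext D A} (h : ξ.IsProper δ) (c : D' ⟶ D) :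
    ξ.IsProper (S.pull c δ) := fun P p hP => by
  rw [← S.pull_comp, h _ hP]

lemma IsProper.eq_zero {P A : C} {δ : S.Ext P A} (h : ξ.IsProper δ) (hP : ξ.IsProjective P) :
    δ = 0 := by simpa using h (𝟙 P) hP

lemma isProper_iff {A B D : C} {x : A ⟶ B} {y : B ⟶ D} {δ : S.Ext D A}
    (h : S.IsTriangle x y δ) : ξ.IsProper δ ↔
      ∀ ⦃P : C⦄ (p : P ⟶ D), ξ.IsProjective P → ∃ q : P ⟶ B, q ≫ y = p :=
  forall_congr' fun _ => forall_congr' fun p => forall_congr' fun _ => h.pull_eq_zero_iff p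

/-- With enough projectives, a proper class consists of the `E`-triangles on which every
`ξ`-projective object is projective: such a triangle splits when pulled back along a projective
cover, so saturation applies. -/
lemma mem_iff [h : ξ.EnoughProjectives] {A B D : C} {x : A ⟶ B} {y : B ⟶ D} {δ : S.Ext D A} :
    ξ.mem x y δ ↔ S.IsTriangle x y δ ∧ ξ.IsProper δ := by
  refine ⟨fun hm => ⟨ξ.isTriangle hm,
    (isProper_iff (ξ.isTriangle hm)).2 fun P p hP => hP.exists_lift hm p⟩, fun ⟨ht, hp⟩ => ?_⟩
  obtain ⟨K, P, g, f, ε, hc, hP⟩ := h.exists_cover D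
  obtain ⟨N, m₁, e₁, m₂, e₂, r₁, r₂, r₃, t₁, t₂⟩ := exists_pullback ht (ξ.isTriangle hc)
  refine ξ.saturated x y δ g f ε m₁ e₁ m₂ e₂ ht (ξ.isTriangle hc) r₁ r₂ r₃ t₁ t₂ hc ?_
  rw [hp f hP] at t₁ ⊢
  exact ξ.split_mem _ _ t₁

end Projective

section Composition

variable {ξ : ProperClass S}

lemma isProper_of_mem [ξ.EnoughProjectives] {A B D : C} {x : A ⟶ B} {y : B ⟶ D}
    {δ : S.Ext D A} (h : ξ.mem x y δ) : ξ.IsProper δ := (mem_iff.1 h).2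

lemma mem_biprod_inl_snd (A D : C) :
    ξ.mem (biprod.inl : A ⟶ A ⊞ D) biprod.snd 0 := ξ.split_mem _ _ (isTriangle_biprod A D)

lemma mem_biprod_inr_fst (A D : C) :
    ξ.mem (biprod.inr : A ⟶ D ⊞ A) biprod.fst 0 := ξ.split_mem _ _ (isTriangle_biprod' A D)

variable [ξ.EnoughProjectives]

/-- Composites of `ξ`-inflations are `ξ`-inflations, with an extension of the cokernels. -/
lemma exists_comp_inflation {A B D X F : C} {f : A ⟶ B} {f' : B ⟶ D} {δ : S.Ext D A}
    {g : B ⟶ X} {g' : X ⟶ F} {δ' : S.Ext F B} (h₁ : ξ.mem f f' δ) (h₂ : ξ.mem g g' δ') :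
    ∃ (Y : C) (h' : X ⟶ Y) (d : D ⟶ Y) (e : Y ⟶ F) (δ'' : S.Ext Y A),
      ξ.mem (f ≫ g) h' δ'' ∧ ξ.mem d e (S.push f' δ') := by
  obtain ⟨Y, h, h', d, e, δ'', rfl, hd, he, ht, hY, -, -⟩ :=
    S.et4 _ _ _ _ _ _ (ξ.isTriangle h₁) (ξ.isTriangle h₂)
  refine ⟨Y, h', d, e, δ'', mem_iff.2 ⟨ht, (isProper_iff ht).2 fun P p hP => ?_⟩,
    mem_iff.2 ⟨hY, (isProper_of_mem h₂).push _⟩⟩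
  -- A map `p` from a projective lifts along `h'` up to a map into `D`, which lifts to `B`.
  obtain ⟨q, hq⟩ := hP.exists_lift h₂ (p ≫ e)
  obtain ⟨r, hr⟩ := IsTriangle.exists_lift hY (p - q ≫ h') (by simp [he, hq])
  obtain ⟨s, hs⟩ := hP.exists_lift h₁ r
  refine ⟨q + s ≫ g, ?_⟩
  rw [Preadditive.add_comp, Category.assoc, ← hd, reassoc_of% hs, hr]
  abel

/-- Composites of `ξ`-deflations are `ξ`-deflations, with an extension of the kernels. -/
lemma exists_comp_deflation {D A B F X : C} {f' : D ⟶ A} {f : A ⟶ B} {δ : S.Ext B D}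
    {g' : F ⟶ B} {g : B ⟶ X} {δ' : S.Ext X F} (h₁ : ξ.mem f' f δ) (h₂ : ξ.mem g' g δ') :
    ∃ (Y : C) (h' : Y ⟶ A) (d : D ⟶ Y) (e : Y ⟶ F) (δ'' : S.Ext X Y),
      ξ.mem h' (f ≫ g) δ'' ∧ ξ.mem d e (S.pull g' δ) := by
  obtain ⟨Y, d, e, h', h, δ'', rfl, -, -, ht, hY, -, -⟩ :=
    S.et4_op _ _ _ _ _ _ (ξ.isTriangle h₁) (ξ.isTriangle h₂)
  refine ⟨Y, h', d, e, δ'', mem_iff.2 ⟨ht, (isProper_iff ht).2 fun P p hP => ?_⟩,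
    mem_iff.2 ⟨hY, (isProper_of_mem h₁).pull _⟩⟩
  obtain ⟨q, rfl⟩ := hP.exists_lift h₂ p
  obtain ⟨r, rfl⟩ := hP.exists_lift h₁ q
  exact ⟨r, by simp⟩

/-- If the pullback of one triangle splits, the middle term of the pullback square is a
biproduct. -/
lemma exists_pullback_split {A₁ A₂ B₁ B₂ D : C} {x₁ : A₁ ⟶ B₁} {y₁ : B₁ ⟶ D} {δ₁ : S.Ext D A₁}
    {x₂ : A₂ ⟶ B₂} {y₂ : B₂ ⟶ D} {δ₂ : S.Ext D A₂} (h₁ : S.IsTriangle x₁ y₁ δ₁)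
    (h₂ : ξ.mem x₂ y₂ δ₂) (h0 : S.pull y₂ δ₁ = 0) :
    ∃ (m : A₂ ⟶ A₁ ⊞ B₂) (e : A₁ ⊞ B₂ ⟶ B₁), ξ.mem m e (S.pull y₁ δ₂) := by
  obtain ⟨N, m₁, e₁, m₂, e₂, -, -, -, t₁, t₂⟩ := exists_pullback h₁ (ξ.isTriangle h₂)
  rw [h0] at t₁
  obtain ⟨b, -, -⟩ := t₁.exists_iso (isTriangle_biprod A₁ B₂)
  exact ⟨_, _, mem_iff.2 ⟨t₂.of_iso_mid b, (isProper_of_mem h₂).pull _⟩⟩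

/-- If the pushout of one triangle splits, the middle term of the pushout square is a
biproduct. -/
lemma exists_pushout_split {A B₁ B₂ D₁ D₂ : C} {x₁ : A ⟶ B₁} {y₁ : B₁ ⟶ D₁} {δ₁ : S.Ext D₁ A}
    {x₂ : A ⟶ B₂} {y₂ : B₂ ⟶ D₂} {δ₂ : S.Ext D₂ A} (h₁ : S.IsTriangle x₁ y₁ δ₁)
    (h₂ : ξ.mem x₂ y₂ δ₂) (h0 : S.push x₂ δ₁ = 0) :
    ∃ (m : B₁ ⟶ B₂ ⊞ D₁) (e : B₂ ⊞ D₁ ⟶ D₂), ξ.mem m e (S.push x₁ δ₂) := by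
  obtain ⟨N, m₁, e₁, m₂, e₂, t₁, t₂⟩ := exists_pushout h₁ (ξ.isTriangle h₂)
  rw [h0] at t₁
  obtain ⟨b, -, -⟩ := t₁.exists_iso (isTriangle_biprod B₂ D₁)
  exact ⟨_, _, mem_iff.2 ⟨t₂.of_iso_mid b, (isProper_of_mem h₂).push _⟩⟩

lemma mem_biprod_left {A B D : C} {x : A ⟶ B} {y : B ⟶ D} {δ : S.Ext D A}
    (h : ξ.mem x y δ) (Q : C) :
    ξ.mem (biprod.map (𝟙 Q) x) (biprod.snd ≫ y) (S.push biprod.inr δ) :=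
  mem_iff.2 ⟨(ξ.isTriangle h).biprod_left Q, (isProper_of_mem h).push _⟩

lemma mem_biprod_right {A B D : C} {x : A ⟶ B} {y : B ⟶ D} {δ : S.Ext D A}
    (h : ξ.mem x y δ) (Q : C) :
    ξ.mem (x ≫ biprod.inl) (biprod.map y (𝟙 Q)) (S.pull biprod.fst δ) :=
  mem_iff.2 ⟨(ξ.isTriangle h).biprod_right Q, (isProper_of_mem h).pull _⟩

end Composition

/-! ### Objects orthogonal to the projectives -/

variable (ξ : ProperClass S)

/-- `X` is orthogonal to the `ξ`-projective objects if proper extensions of `X` by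
`ξ`-projectives split, and a map from `X` to a `ξ`-projective is zero as soon as all its
composites with maps from `ξ`-projectives are zero. With enough projectives, this means that every
triangle in `ξ` ending in `X` is `C(-, P(ξ))`-exact; the second condition accounts for the
injectivity on the left, which is not automatic as deflations need not be epimorphisms. -/
structure IsOrthogonal (X : C) : Prop where
  ext_eq_zero : ∀ ⦃Q : C⦄ (η : S.Ext X Q), ξ.IsProjective Q → ξ.IsProper η → η = 0
  hom_eq_zero : ∀ ⦃Q : C⦄ (h : X ⟶ Q), ξ.IsProjective Q →
    (∀ ⦃P : C⦄ (p : P ⟶ X), ξ.IsProjective P → p ≫ h = 0) → h = 0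

variable {ξ}

lemma IsOrthogonal.of_isProjective {P : C} (hP : ξ.IsProjective P) : ξ.IsOrthogonal P where
  ext_eq_zero _ _ _ h := h.eq_zero hP
  hom_eq_zero _ h _ hh := by simpa using hh (𝟙 P) hP

lemma IsOrthogonal.of_retract {X Y : C} (hY : ξ.IsOrthogonal Y) (i : X ⟶ Y) (r : Y ⟶ X)
    (hir : i ≫ r = 𝟙 X) : ξ.IsOrthogonal X where
  ext_eq_zero Q η hQ hη := by
    have := congrArg (S.pull i) (hY.ext_eq_zero _ hQ (hη.pull r))
    rwa [← S.pull_comp, hir, S.pull_id, S.pull_zero] at this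
  hom_eq_zero Q h hQ hh := by
    have := hY.hom_eq_zero (r ≫ h) hQ fun P p hP => by
      rw [← Category.assoc]; exact hh _ hP
    simpa [reassoc_of% hir] using congrArg (fun t => i ≫ t) this

lemma IsOrthogonal.of_homExactTo {K P X : C} {x : K ⟶ P} {y : P ⟶ X} {δ : S.Ext X K}
    (h : S.IsTriangle x y δ) (hP : ξ.IsProjective P)
    (hx : ∀ Q : C, ξ.IsProjective Q → HomExactTo Q x y) : ξ.IsOrthogonal X where
  ext_eq_zero Q η hQ hη := by
    obtain ⟨B, u, v, hB⟩ := exists_isTriangle η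
    obtain ⟨b, hb⟩ := (hB.pull_eq_zero_iff y).1 (hη y hP)
    -- `η` is the pushout of `δ` along a map that extends to `P`.
    obtain ⟨a, -, ha⟩ := S.et3_op x y δ u v η h hB b (𝟙 X) (by simp [hb])
    rw [S.pull_id] at ha
    rw [← ha, h.push_eq_zero_iff]
    exact (hx Q hQ).2.2 a
  hom_eq_zero Q f hQ hf := (hx Q hQ).1 (by simpa using hf y hP)

lemma IsOrthogonal.homExactTo [ξ.EnoughProjectives] {A B X Q : C} (hX : ξ.IsOrthogonal X)
    (hQ : ξ.IsProjective Q) {x : A ⟶ B} {y : B ⟶ X} {δ : S.Ext X A} (h : ξ.mem x y δ) :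
    HomExactTo Q x y := by
  have ht := ξ.isTriangle h
  refine ⟨fun f g hfg => ?_, fun b => ⟨fun hb => ht.exists_desc b hb, ?_⟩, fun a => ?_⟩
  · dsimp only at hfg
    rw [← sub_eq_zero]
    refine hX.hom_eq_zero _ hQ fun P p hP => ?_
    obtain ⟨q, rfl⟩ := hP.exists_lift h p
    simp [hfg]
  · rintro ⟨c, rfl⟩
    simp [reassoc_of% ht.comp_eq_zero]
  · exact (ht.push_eq_zero_iff a).1 (hX.ext_eq_zero _ hQ ((isProper_of_mem h).push a))

/-- Orthogonal objects are closed under extensions in `ξ`. -/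
lemma IsOrthogonal.of_ext [ξ.EnoughProjectives] {A B D : C} {x : A ⟶ B} {y : B ⟶ D}
    {δ : S.Ext D A} (h : ξ.mem x y δ) (hA : ξ.IsOrthogonal A) (hD : ξ.IsOrthogonal D) :
    ξ.IsOrthogonal B where
  ext_eq_zero Q η hQ hη := by
    obtain ⟨θ, rfl⟩ := (ξ.isTriangle h).exists_pull_eq η (hA.ext_eq_zero _ hQ (hη.pull x))
    rw [hD.ext_eq_zero θ hQ fun P p hP => ?_, S.pull_zero]
    obtain ⟨q, rfl⟩ := hP.exists_lift h p
    rw [S.pull_comp]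
    exact hη q hP
  hom_eq_zero Q f hQ hf := by
    obtain ⟨g, rfl⟩ := (ξ.isTriangle h).exists_desc f (hA.hom_eq_zero _ hQ fun P p hP => by
      rw [← Category.assoc]; exact hf _ hP)
    rw [hD.hom_eq_zero g hQ fun P p hP => ?_, comp_zero]
    obtain ⟨q, rfl⟩ := hP.exists_lift h p
    rw [Category.assoc]
    exact hf q hP

/-! ### A coinductive description of Gorenstein projective objects -/

variable (ξ)

/-- A class of orthogonal objects, each of which is both a syzygy and a cosyzygy, by
`ξ`-projectives, of objects in the class. -/
structure IsTotallyAcyclic (𝒳 : C → Prop) : Prop where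
  orthogonal : ∀ ⦃X⦄, 𝒳 X → ξ.IsOrthogonal X
  cover : ∀ ⦃X⦄, 𝒳 X → ∃ (K P : C) (x : K ⟶ P) (y : P ⟶ X) (δ : S.Ext X K),
    ξ.mem x y δ ∧ ξ.IsProjective P ∧ 𝒳 K
  hull : ∀ ⦃X⦄, 𝒳 X → ∃ (P L : C) (x : X ⟶ P) (y : P ⟶ L) (δ : S.Ext L X),
    ξ.mem x y δ ∧ ξ.IsProjective P ∧ 𝒳 L

lemma isTotallyAcyclic_isGProjective : ξ.IsTotallyAcyclic ξ.IsGProjective where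
  orthogonal := by
    rintro X ⟨P, e, he, n, ⟨i⟩⟩
    exact (IsOrthogonal.of_homExactTo (ξ.isTriangle (e.mem n)) (he.projective n)
      (he.exact n)).of_retract i.hom i.inv i.hom_inv_id
  cover := by
    rintro X ⟨P, e, he, n, ⟨i⟩⟩
    refine ⟨e.K (n + 1), P.X n, e.g n, e.f n ≫ i.inv, S.pull i.hom (e.δ n), ?_,
      he.projective n, P, e, he, n + 1, ⟨Iso.refl _⟩⟩
    exact ξ.closed_iso _ _ _ _ _ _ (Iso.refl _) (Iso.refl _) i.symm (e.mem n)
      ((ξ.isTriangle (e.mem n)).of_iso_right i.symm) (by simp) (by simp)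
      (by simp [← S.pull_comp])
  hull := by
    rintro X ⟨P, e, he, n, ⟨i⟩⟩
    obtain ⟨m, rfl⟩ : ∃ m, n = m + 1 := ⟨n - 1, by simp⟩
    refine ⟨P.X m, e.K m, i.hom ≫ e.g m, e.f m, S.push i.inv (e.δ m), ?_,
      he.projective m, P, e, he, m, ⟨Iso.refl _⟩⟩
    exact ξ.closed_iso _ _ _ _ _ _ i.symm (Iso.refl _) (Iso.refl _) (e.mem m)
      ((ξ.isTriangle (e.mem m)).of_iso_left i.symm) (by simp) (by simp) (by simp)

variable {ξ}

/-- Coinduction for Gorenstein projectivity: a complete resolution is spliced from the covers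
and hulls in a totally acyclic class. -/
lemma IsTotallyAcyclic.isGProjective [ξ.EnoughProjectives] {𝒳 : C → Prop}
    (h : ξ.IsTotallyAcyclic 𝒳) {X : C} (hX : 𝒳 X) : ξ.IsGProjective X := by
  have hs : ∀ A : {X // 𝒳 X}, ∃ (K : {X // 𝒳 X}) (P : C) (x : K.1 ⟶ P) (y : P ⟶ A.1)
      (δ : S.Ext A.1 K.1), ξ.mem x y δ ∧ ξ.IsProjective P := fun A => by
    obtain ⟨K, P, x, y, δ, hm, hP, hK⟩ := h.cover A.2
    exact ⟨⟨K, hK⟩, P, x, y, δ, hm, hP⟩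
  have hc : ∀ A : {X // 𝒳 X}, ∃ (L : {X // 𝒳 X}) (P : C) (x : A.1 ⟶ P) (y : P ⟶ L.1)
      (δ : S.Ext L.1 A.1), ξ.mem x y δ ∧ ξ.IsProjective P := fun A => by
    obtain ⟨P, L, x, y, δ, hm, hP, hL⟩ := h.hull A.2
    exact ⟨⟨L, hL⟩, P, x, y, δ, hm, hP⟩
  choose syz hsyz using hs
  choose cosyz hcosyz using hc
  let K : ℤ → {X // 𝒳 X} := fun
    | .ofNat n => syz^[n] ⟨X, hX⟩
    | .negSucc n => cosyz^[n + 1] ⟨X, hX⟩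
  have hK : ∀ n : ℤ, ∃ (P : C) (x : (K (n + 1)).1 ⟶ P) (y : P ⟶ (K n).1)
      (δ : S.Ext (K n).1 (K (n + 1)).1), ξ.mem x y δ ∧ ξ.IsProjective P := by
    rintro (n | n)
    · have e : K (.ofNat n + 1) = syz (K (.ofNat n)) := Function.iterate_succ_apply' syz n _
      rw [e]
      exact hsyz _
    · have e : K (.negSucc n) = cosyz (K (.negSucc n + 1)) := by
        cases n with
        | zero => rfl
        | succ n => exact Function.iterate_succ_apply' cosyz (n + 1) _
      rw [e]
      exact hcosyz _
  choose P x y δ hm hP using hK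
  refine ⟨ChainComplex.of P (fun n => y (n + 1) ≫ x n) fun n => ?_,
    { K := fun n => (K n).1
      g := x
      f := y
      δ := δ
      mem := hm
      d_eq := fun n => by simp only [ChainComplex.of_d] },
    ⟨hP, fun n Q hQ => (h.orthogonal (K n).2).homExactTo hQ (hm n)⟩, 0, ⟨Iso.refl _⟩⟩
  rw [Category.assoc, reassoc_of% (ξ.isTriangle (hm (n + 1))).comp_eq_zero]
  simp

lemma IsGProjective.isOrthogonal {G : C} (hG : ξ.IsGProjective G) : ξ.IsOrthogonal G :=
  ξ.isTotallyAcyclic_isGProjective.orthogonal hG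

lemma IsGProjective.of_iso {G G' : C} (hG : ξ.IsGProjective G) (i : G ≅ G') :
    ξ.IsGProjective G' := by
  obtain ⟨X, e, he, n, ⟨j⟩⟩ := hG
  exact ⟨X, e, he, n, ⟨i.symm ≪≫ j⟩⟩

section

variable [ξ.EnoughProjectives]

lemma IsProjective.isGProjective {P : C} (hP : ξ.IsProjective P) : ξ.IsGProjective P :=
  IsTotallyAcyclic.isGProjective (𝒳 := ξ.IsProjective)
    { orthogonal := fun _ => IsOrthogonal.of_isProjective
      cover := fun X hX => ⟨0, X, 0, 𝟙 X, 0, ξ.split_mem _ _ (isTriangle_id_right X), hX,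
        ξ.isProjective_zero⟩
      hull := fun X hX => ⟨X, 0, 𝟙 X, 0, 0, ξ.split_mem _ _ (isTriangle_id_left X), hX,
        ξ.isProjective_zero⟩ } hP

/-- An orthogonal object is Gorenstein projective if its first syzygy and cosyzygy are: adding it to
the class of Gorenstein projective objects keeps that class totally acyclic. -/
lemma isGProjective_of_cover_of_hull {X K P P' L : C} (hX : ξ.IsOrthogonal X) {x : K ⟶ P}
    {y : P ⟶ X} {δ : S.Ext X K} (h : ξ.mem x y δ) (hP : ξ.IsProjective P)
    (hK : ξ.IsGProjective K) {x' : X ⟶ P'} {y' : P' ⟶ L} {δ' : S.Ext L X} (h' : ξ.mem x' y' δ')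
    (hP' : ξ.IsProjective P') (hL : ξ.IsGProjective L) : ξ.IsGProjective X := by
  have hG := ξ.isTotallyAcyclic_isGProjective
  refine IsTotallyAcyclic.isGProjective (𝒳 := fun Y => ξ.IsGProjective Y ∨ Y = X)
    { orthogonal := ?_, cover := ?_, hull := ?_ } (Or.inr rfl)
  · rintro Y (hY | rfl)
    exacts [hY.isOrthogonal, hX]
  · rintro Y (hY | rfl)
    · obtain ⟨K', Q, a, b, ε, hm, hQ, hK'⟩ := hG.cover hY
      exact ⟨K', Q, a, b, ε, hm, hQ, Or.inl hK'⟩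
    · exact ⟨K, P, x, y, δ, h, hP, Or.inl hK⟩
  · rintro Y (hY | rfl)
    · obtain ⟨Q, L', a, b, ε, hm, hQ, hL'⟩ := hG.hull hY
      exact ⟨Q, L', a, b, ε, hm, hQ, Or.inl hL'⟩
    · exact ⟨P', L, x', y', δ', h', hP', Or.inl hL⟩

/-! ### Closure properties of Gorenstein projective objects -/

/-- Gorenstein projective objects are closed under extensions in `ξ`. Orthogonality splits the
pushout along a hull of `A`, and projectivity splits the pullback along a cover of `D`; composing
with a hull of `D`, respectively a cover of `A`, gives a hull and a cover of `B` whose third terms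
are again extensions. -/
lemma IsGProjective.of_ext {A B D : C} {x : A ⟶ B} {y : B ⟶ D} {δ : S.Ext D A}
    (h : ξ.mem x y δ) (hA : ξ.IsGProjective A) (hD : ξ.IsGProjective D) :
    ξ.IsGProjective B := by
  have hG := ξ.isTotallyAcyclic_isGProjective
  refine IsTotallyAcyclic.isGProjective (𝒳 := fun B => ∃ (A D : C) (x : A ⟶ B) (y : B ⟶ D)
    (δ : S.Ext D A), ξ.mem x y δ ∧ ξ.IsGProjective A ∧ ξ.IsGProjective D)
    { orthogonal := ?_, cover := ?_, hull := ?_ } ⟨A, D, x, y, δ, h, hA, hD⟩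
  all_goals
    clear h hA hD x y δ
    rintro B ⟨A, D, x, y, δ, h, hA, hD⟩
  · exact .of_ext h hA.isOrthogonal hD.isOrthogonal
  · obtain ⟨K₁, P₁, a₁, b₁, ε₁, h₁, hP₁, hK₁⟩ := hG.cover hA
    obtain ⟨K₂, P₂, a₂, b₂, ε₂, h₂, hP₂, hK₂⟩ := hG.cover hD
    obtain ⟨m, e, hm⟩ := exists_pullback_split (ξ.isTriangle h) h₂ (isProper_of_mem h b₂ hP₂)
    obtain ⟨Y, i, d, e', ε, hi, hY⟩ := exists_comp_deflation (mem_biprod_right h₁ P₂) hm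
    exact ⟨Y, P₁ ⊞ P₂, _, _, _, hi, hP₁.biprod hP₂, K₁, K₂, _, _, _, hY, hK₁, hK₂⟩
  · obtain ⟨P₁, L₁, a₁, b₁, ε₁, h₁, hP₁, hL₁⟩ := hG.hull hA
    obtain ⟨P₂, L₂, a₂, b₂, ε₂, h₂, hP₂, hL₂⟩ := hG.hull hD
    obtain ⟨m, e, hm⟩ := exists_pushout_split (ξ.isTriangle h) h₁
      (hD.isOrthogonal.ext_eq_zero _ hP₁ ((isProper_of_mem h).push a₁))
    obtain ⟨Y, i, d, e', ε, hi, hY⟩ := exists_comp_inflation hm (mem_biprod_left h₂ P₁)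
    exact ⟨P₁ ⊞ P₂, Y, _, _, _, hi, hP₁.biprod hP₂, L₁, L₂, _, _, _, hY, hL₁, hL₂⟩

lemma IsGProjective.biprod {G G' : C} (hG : ξ.IsGProjective G) (hG' : ξ.IsGProjective G') :
    ξ.IsGProjective (G ⊞ G') :=
  .of_ext (mem_biprod_inl_snd G G') hG hG'

/-- A complement of a `ξ`-projective object in a Gorenstein projective object is Gorenstein
projective: its first syzygy and cosyzygy are extensions of Gorenstein projectives. -/
lemma IsGProjective.of_biprod {G P : C} (h : ξ.IsGProjective (G ⊞ P)) (hP : ξ.IsProjective P) :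
    ξ.IsGProjective G := by
  have hG := ξ.isTotallyAcyclic_isGProjective
  obtain ⟨K, P₁, a₁, b₁, ε₁, h₁, hP₁, hK⟩ := hG.cover h
  obtain ⟨P₂, L, a₂, b₂, ε₂, h₂, hP₂, hL⟩ := hG.hull h
  obtain ⟨Y, i, d, e, ε, hi, hY⟩ := exists_comp_deflation h₁ (mem_biprod_inr_fst P G)
  obtain ⟨Y', i', d', e', ε', hi', hY'⟩ := exists_comp_inflation (mem_biprod_inl_snd G P) h₂
  exact isGProjective_of_cover_of_hull
    (h.isOrthogonal.of_retract biprod.inl biprod.fst (by simp)) hi hP₁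
    (.of_ext hY hK hP.isGProjective) hi' hP₂ (.of_ext hY' hP.isGProjective hL)

/-- Kernels of `ξ`-deflations between Gorenstein projective objects are Gorenstein projective. -/
lemma IsGProjective.of_kernel {A B D : C} {x : A ⟶ B} {y : B ⟶ D} {δ : S.Ext D A}
    (h : ξ.mem x y δ) (hB : ξ.IsGProjective B) (hD : ξ.IsGProjective D) :
    ξ.IsGProjective A := by
  obtain ⟨K, P, a, b, ε, h', hP, hK⟩ := ξ.isTotallyAcyclic_isGProjective.cover hD
  obtain ⟨m, e, hm⟩ := exists_pullback_split (ξ.isTriangle h) h' (isProper_of_mem h b hP)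
  exact IsGProjective.of_biprod (.of_ext hm hK hB) hP

/-- A cokernel of Gorenstein projective objects is Gorenstein projective if maps from the kernel
to `ξ`-projectives extend to the middle term; injectivity of `C(D, Q) ⟶ C(B, Q)` need not be
assumed. The pushout along a hull of `A` shows that `P ⊞ D` is Gorenstein projective. -/
lemma IsGProjective.of_cokernel {A B D : C} {x : A ⟶ B} {y : B ⟶ D} {δ : S.Ext D A}
    (h : ξ.mem x y δ) (hA : ξ.IsGProjective A) (hB : ξ.IsGProjective B)
    (hD : ∀ ⦃Q : C⦄ (a : A ⟶ Q), ξ.IsProjective Q → S.push a δ = 0) :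
    ξ.IsGProjective D := by
  obtain ⟨P, L, a, b, ε, h', hP, hL⟩ := ξ.isTotallyAcyclic_isGProjective.hull hA
  obtain ⟨m, e, hm⟩ := exists_pushout_split (ξ.isTriangle h) h' (hD a hP)
  exact IsGProjective.of_biprod
    ((IsGProjective.of_ext hm hB hL).of_iso (biprod.braiding P D)) hP

end

/-! ### Relative dimensions -/

lemma DimLE.succ {𝒲 : C → Prop} : ∀ {n : ℕ} {A : C}, ξ.DimLE 𝒲 n A → ξ.DimLE 𝒲 (n + 1) A
  | 0, _, h => Or.inl h
  | _ + 1, _, .inl h => Or.inl h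
  | _ + 1, _, .inr ⟨K, W, g, f, δ, hm, hW, hK⟩ => Or.inr ⟨K, W, g, f, δ, hm, hW, hK.succ⟩

lemma DimLE.mono {𝒲 : C → Prop} {m n : ℕ} (hmn : m ≤ n) {A : C} (h : ξ.DimLE 𝒲 m A) :
    ξ.DimLE 𝒲 n A :=
  Nat.le_induction h (fun _ _ h => h.succ) n hmn

lemma DimLE.of_mem {𝒲 : C → Prop} {A : C} (n : ℕ) (h : 𝒲 A) : ξ.DimLE 𝒲 n A :=
  DimLE.mono (m := 0) (Nat.zero_le n) h

lemma dim_le_iff {𝒲 : C → Prop} {A : C} {n : ℕ} : ξ.dim 𝒲 A ≤ n ↔ ξ.DimLE 𝒲 n A := by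
  refine ⟨fun h => ?_, fun h => iInf₂_le n h⟩
  by_contra hn
  have : ((n + 1 : ℕ) : ℕ∞) ≤ ξ.dim 𝒲 A := le_iInf₂ fun k hk => by
    by_contra hlt
    refine hn (hk.mono ?_)
    simp only [not_le, Nat.cast_lt] at hlt
    lia
  have := this.trans h
  norm_cast at this
  lia

lemma dim_lt_top_iff {𝒲 : C → Prop} {A : C} : ξ.dim 𝒲 A < ⊤ ↔ ∃ n, ξ.DimLE 𝒲 n A := by
  constructor
  · intro h
    obtain ⟨n, hn⟩ := ENat.ne_top_iff_exists.1 h.ne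
    exact ⟨n, dim_le_iff.1 hn.ge⟩
  · rintro ⟨n, hn⟩
    exact (dim_le_iff.2 hn).trans_lt (ENat.natCast_lt_top n)

/-! ### Cohomology of a projective resolution -/

namespace ProjectiveResolution

variable {M : C} (R : ξ.ProjectiveResolution M)

/-- Exactness of `C(P, B)` in degree `i + 1`. -/
def HomExactAt (i : ℕ) (B : C) : Prop :=
  ∀ φ : R.P.X (i + 1) ⟶ B, R.P.d (i + 2) (i + 1) ≫ φ = 0 →
    ∃ χ : R.P.X i ⟶ B, R.P.d (i + 1) i ≫ χ = φ

/-- Dimension shifting in the second variable: for `K ⟶ W ⟶ Q ⇢` in `ξ`, a cocycle in `Q` lifts to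
`W`, and the coboundary of the lift is a cocycle in `K`, one degree higher. -/
lemma homExactAt_of_dimLE {n k : ℕ} (h : ∀ i, n ≤ i → ∀ Q : C, ξ.IsProjective Q → R.HomExactAt i Q)
    {Q : C} (hQ : ξ.DimLE ξ.IsProjective k Q) {i : ℕ} (hi : n ≤ i) : R.HomExactAt i Q := by
  induction k generalizing Q i with
  | zero => exact h i hi Q hQ
  | succ k ih =>
    obtain hQ | ⟨K, W, g, f, δ, hm, hW, hK⟩ := hQ
    · exact h i hi Q hQ
    · intro φ hφ
      obtain ⟨φ', rfl⟩ := IsProjective.exists_lift (R.projective (i + 1)) hm φ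
      obtain ⟨ψ, hψ⟩ := (ξ.isTriangle hm).exists_lift (R.P.d (i + 2) (i + 1) ≫ φ') (by
        rw [Category.assoc, hφ])
      obtain ⟨χ, rfl⟩ := ih hK (i := i + 1) (by lia) ψ
        ((R.projective (i + 3) _ _ _ hm).1 (by simp [hψ]))
      obtain ⟨ρ, hρ⟩ := h i hi W hW (φ' - χ ≫ g) (by simp [← hψ])
      refine ⟨ρ ≫ f, ?_⟩
      rw [reassoc_of% hρ]
      simp [(ξ.isTriangle hm).comp_eq_zero]

end ProjectiveResolution

/-- Only positive degrees are treated; degree `0` plays no role in the vanishing statements. -/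
lemma isZero_xt_succ_iff [ξ.EnoughProjectives] (i : ℕ) (M B : C) :
    IsZero (ξ.xt (i + 1) M B) ↔ (ξ.projectiveResolution M).HomExactAt i B := by
  unfold xt
  rw [← HomologicalComplex.exactAt_iff_isZero_homology,
    HomologicalComplex.exactAt_iff' _ i (i + 1) (i + 2) (ComplexShape.prev_eq' _ rfl)
      (ComplexShape.next_eq' _ rfl),
    ShortComplex.ab_exact_iff]
  -- Elementwise exactness of this short complex is `HomExactAt` by definition.
  exact Iff.rfl

/-! ### Gorenstein projective dimension and syzygies -/

section GDim

variable [ξ.EnoughProjectives]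

lemma dimLE_isGProjective_of_iso {A B : C} (i : A ≅ B) :
    ∀ {n : ℕ}, ξ.DimLE ξ.IsGProjective n A → ξ.DimLE ξ.IsGProjective n B
  | 0, h => IsGProjective.of_iso h i
  | _ + 1, .inl h => Or.inl (h.of_iso i)
  | _ + 1, .inr ⟨K, W, g, f, δ, hm, hW, hK⟩ => Or.inr ⟨K, W, g, f ≫ i.hom, S.pull i.inv δ,
      mem_iff.2 ⟨(ξ.isTriangle hm).of_iso_right i, (isProper_of_mem hm).pull _⟩, hW, hK⟩

lemma dimLE_isGProjective_biprod {A P : C} (hP : ξ.IsProjective P) :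
    ∀ {n : ℕ}, ξ.DimLE ξ.IsGProjective n A → ξ.DimLE ξ.IsGProjective n (A ⊞ P)
  | 0, h => IsGProjective.biprod h hP.isGProjective
  | _ + 1, .inl h => Or.inl (h.biprod hP.isGProjective)
  | _ + 1, .inr ⟨K, W, _, _, _, hm, hW, hK⟩ => Or.inr
      ⟨K, W ⊞ P, _, _, _, mem_biprod_right hm P, hW.biprod hP.isGProjective, hK⟩

lemma dimLE_isGProjective_of_kernel {A B D : C} {x : A ⟶ B} {y : B ⟶ D} {δ : S.Ext D A}
    (h : ξ.mem x y δ) (hD : ξ.IsGProjective D) :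
    ∀ {n : ℕ}, ξ.DimLE ξ.IsGProjective n B → ξ.DimLE ξ.IsGProjective n A
  | 0, hB => IsGProjective.of_kernel h hB hD
  | _ + 1, .inl hB => Or.inl (.of_kernel h hB hD)
  | _ + 1, .inr ⟨K, W, g, f, ε, hm, hW, hK⟩ => by
    obtain ⟨Y, i, d, e, ε', hi, hY⟩ := exists_comp_deflation hm h
    exact Or.inr ⟨K, Y, d, e, _, hY, .of_kernel hi hW hD, hK⟩

/-- Passing to a syzygy with respect to any `ξ`-projective cover lowers the Gorenstein projective
dimension: the pullback of two covers is a biproduct, so covers by Gorenstein projectives and by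
projectives can be compared. -/
lemma dimLE_isGProjective_syzygy {n : ℕ} {A K P : C} (hA : ξ.DimLE ξ.IsGProjective (n + 1) A)
    {x : K ⟶ P} {y : P ⟶ A} {δ : S.Ext A K} (h : ξ.mem x y δ) (hP : ξ.IsProjective P) :
    ξ.DimLE ξ.IsGProjective n K := by
  obtain hA | ⟨L, W, g, f, ε, hm, hW, hL⟩ := hA
  · exact DimLE.of_mem n (IsGProjective.of_kernel h hP.isGProjective hA)
  · obtain ⟨m, e, hk⟩ := exists_pullback_split (ξ.isTriangle hm) h (isProper_of_mem hm y hP)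
    exact dimLE_isGProjective_of_kernel hk hW (dimLE_isGProjective_biprod hP hL)

namespace ProjectiveResolution

variable {M : C} (R : ξ.ProjectiveResolution M)

lemma isGProjective_of_le {n : ℕ} (hM : ξ.DimLE ξ.IsGProjective n M) {j : ℕ} (hj : n ≤ j) :
    ξ.IsGProjective (R.K j) := by
  have key : ∀ k i : ℕ, ξ.DimLE ξ.IsGProjective (k + i) M → ξ.DimLE ξ.IsGProjective k (R.K i) := by
    intro k i
    induction i generalizing k with
    | zero => exact dimLE_isGProjective_of_iso R.iso.symm
    | succ i ih =>
      intro h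
      exact dimLE_isGProjective_syzygy (ih (k + 1) (by rwa [show k + 1 + i = k + (i + 1) by lia]))
        (R.mem i) (R.projective i)
  exact key 0 j (hM.mono (by lia))

lemma dimLE_of_isGProjective {n : ℕ} (h : ξ.IsGProjective (R.K n)) :
    ξ.DimLE ξ.IsGProjective n M := by
  have key : ∀ k i : ℕ, ξ.IsGProjective (R.K (i + k)) → ξ.DimLE ξ.IsGProjective k (R.K i) := by
    intro k
    induction k with
    | zero => exact fun i h => h
    | succ k ih =>
      intro i h
      exact Or.inr ⟨_, _, _, _, _, R.mem i, IsProjective.isGProjective (R.projective i),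
        ih (i + 1) (by rwa [show i + 1 + k = i + (k + 1) by lia])⟩
  exact dimLE_isGProjective_of_iso R.iso (key n 0 (by rwa [Nat.zero_add]))

lemma homExactAt_of_isGProjective {n i : ℕ} (h : ∀ j, n ≤ j → ξ.IsGProjective (R.K j))
    (hi : n ≤ i) {Q : C} (hQ : ξ.IsProjective Q) : R.HomExactAt i Q := by
  intro φ hφ
  have hx : ∀ j, n ≤ j → HomExactTo Q (R.g j) (R.f j) := fun j hj =>
    (h j hj).isOrthogonal.homExactTo hQ (R.mem j)
  rw [R.d_eq, Category.assoc] at hφ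
  obtain ⟨ψ, rfl⟩ := (ξ.isTriangle (R.mem (i + 1))).exists_desc φ
    ((hx (i + 2) (by lia)).1 (by simpa using hφ))
  obtain ⟨χ, rfl⟩ := (hx i hi).2.2 ψ
  exact ⟨χ, by simp [R.d_eq]⟩

/-- If all high syzygies are Gorenstein projective, exactness of `C(P, Q)` in degrees above `n`
brings Gorenstein projectivity down to the `n`-th syzygy. -/
lemma isGProjective_of_homExactAt {n m : ℕ} (hm : ξ.IsGProjective (R.K (n + m)))
    (h : ∀ i, n ≤ i → ∀ Q : C, ξ.IsProjective Q → R.HomExactAt i Q) :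
    ξ.IsGProjective (R.K n) := by
  induction m with
  | zero => exact hm
  | succ m ih =>
    refine ih (.of_cokernel (R.mem (n + m)) hm (IsProjective.isGProjective (R.projective _))
      fun Q a hQ => ?_)
    rw [(ξ.isTriangle (R.mem _)).push_eq_zero_iff]
    obtain ⟨χ, hχ⟩ := h (n + m) (by lia) Q hQ (R.f (n + m + 1) ≫ a) (by
      rw [R.d_eq, Category.assoc,
        reassoc_of% (ξ.isTriangle (R.mem (n + m + 1))).comp_eq_zero]
      simp)
    rw [R.d_eq, Category.assoc] at hχ
    -- `f (n + m + 1)` need not be an epimorphism, but it can be cancelled before maps to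
    -- `ξ`-projectives because its target is Gorenstein projective.
    exact ⟨χ, (hm.isOrthogonal.homExactTo hQ (R.mem (n + m + 1))).1 hχ⟩

end ProjectiveResolution

/-- A Gorenstein projective dimension is recovered as a supremum from a vanishing criterion. -/
lemma gpd_eq_iSup {M : C} (hM : ξ.Gpd M < ⊤) {𝒲 : C → Prop}
    (h : ∀ n : ℕ, ξ.Gpd M ≤ n ↔ ∀ Q : C, 𝒲 Q → ∀ i : ℕ, n + 1 ≤ i → IsZero (ξ.xt i M Q)) :
    ξ.Gpd M = ⨆ (i : ℕ) (_ : ∃ Q : C, 𝒲 Q ∧ ¬ IsZero (ξ.xt i M Q)), (i : ℕ∞) := by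
  apply le_antisymm
  · generalize hs : (⨆ (i : ℕ) (_ : ∃ Q : C, 𝒲 Q ∧ ¬ IsZero (ξ.xt i M Q)), (i : ℕ∞)) = s
    cases s with
    | top => exact le_top
    | coe n =>
      refine (h n).2 fun Q hQ i hi => ?_
      by_contra hz
      have : (i : ℕ∞) ≤ n := hs ▸ le_iSup₂_of_le i ⟨Q, hQ, hz⟩ le_rfl
      norm_cast at this
      lia
  · obtain ⟨n, hn⟩ := ENat.ne_top_iff_exists.1 hM.ne
    refine iSup₂_le fun i ⟨Q, hQ, hz⟩ => ?_
    rw [← hn]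
    by_contra hi
    simp only [not_le, Nat.cast_lt] at hi
    exact hz ((h n).1 hn.ge Q hQ i hi)

lemma tfae_gpd_le {M : C} (hM : ξ.Gpd M < ⊤) (n : ℕ) : List.TFAE [
    ξ.Gpd M ≤ n,
    ∀ Q : C, ξ.pd Q < ⊤ → ∀ i : ℕ, n + 1 ≤ i → IsZero (ξ.xt i M Q),
    ∀ Q : C, ξ.IsProjective Q → ∀ i : ℕ, n + 1 ≤ i → IsZero (ξ.xt i M Q)] := by
  let R := ξ.projectiveResolution M
  have shift : ∀ Q : C, (∀ i : ℕ, n + 1 ≤ i → IsZero (ξ.xt i M Q)) ↔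
      ∀ i, n ≤ i → R.HomExactAt i Q := fun Q =>
    ⟨fun h i hi => (isZero_xt_succ_iff i M Q).1 (h (i + 1) (by lia)), fun h i hi => by
      obtain ⟨j, rfl⟩ : ∃ j, i = j + 1 := ⟨i - 1, by lia⟩
      exact (isZero_xt_succ_iff j M Q).2 (h j (by lia))⟩
  simp only [shift]
  tfae_have 1 → 3 := fun h Q hQ i hi => R.homExactAt_of_isGProjective
    (fun j hj => R.isGProjective_of_le (dim_le_iff.1 h) hj) hi hQ
  tfae_have 3 → 2 := fun h Q hQ i hi => by
    obtain ⟨k, hk⟩ := dim_lt_top_iff.1 hQ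
    exact R.homExactAt_of_dimLE (fun i hi Q hQ => h Q hQ i hi) hk hi
  tfae_have 2 → 1 := fun h => by
    obtain ⟨m, hm⟩ := dim_lt_top_iff.1 hM
    exact dim_le_iff.2 (R.dimLE_of_isGProjective (R.isGProjective_of_homExactAt
      (R.isGProjective_of_le hm (Nat.le_add_left m n))
      fun i hi Q hQ => h Q (dim_lt_top_iff.2 ⟨0, hQ⟩) i hi))
  tfae_finish

end GDim

end ProperClass

end Extri

theorem mainTheorem3 {C : Type u} [Category.{v} C] [Preadditive C] [HasZeroObject C]
    [HasBinaryBiproducts C]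
    (S : Extri.Extriangulated.{w} C) (hS : S.WeaklyIdempotentComplete)
    (ξ : Extri.ProperClass S) [ξ.EnoughProjectives] [ξ.EnoughInjectives]
    (M : C) (hM : ξ.Gpd M < ⊤) :
    (∀ n : ℕ, List.TFAE [
      ξ.Gpd M ≤ n,
      ∀ Q : C, ξ.pd Q < ⊤ → ∀ i : ℕ, n + 1 ≤ i → IsZero (ξ.xt i M Q),
      ∀ Q : C, ξ.IsProjective Q → ∀ i : ℕ, n + 1 ≤ i → IsZero (ξ.xt i M Q)]) ∧
    ξ.Gpd M = (⨆ (i : ℕ) (_ : ∃ Q : C, ξ.IsProjective Q ∧ ¬ IsZero (ξ.xt i M Q)), (i : ℕ∞)) ∧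
    ξ.Gpd M = (⨆ (i : ℕ) (_ : ∃ Q : C, ξ.pd Q < ⊤ ∧ ¬ IsZero (ξ.xt i M Q)), (i : ℕ∞)) :=
  ⟨Extri.ProperClass.tfae_gpd_le hM,
    Extri.ProperClass.gpd_eq_iSup hM fun n => (Extri.ProperClass.tfae_gpd_le hM n).out 0 2,
    Extri.ProperClass.gpd_eq_iSup hM fun n => (Extri.ProperClass.tfae_gpd_le hM n).out 0 1⟩
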